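/- Let $N\ge 0$, let $x_1<\dots<x_N$ and $\omega_1,\dots,\omega_N$ be real and let $|m_1|,\dots,|m_N|$ be pairwise distinct positive numbers; they describe the discrete measure $m=2\sum_{j=1}^N|m_j|e^{i\omega_j}\delta_{x_j}$, with $m_j=|m_j|e^{i\omega_j}$. Put $h_j=m_je^{x_j}=|m_j|e^{x_j+i\omega_j}$, $g_j=\overline{m_j}e^{-x_j}=|m_j|e^{-x_j-i\omega_j}$, and let the polynomials $q_k(z),p_k(z)$ be defined by $$q_0=0,\quad p_0=1,\qquad q_k-q_{k-1}=h_kp_{k-1},\quad p_k-p_{k-1}=-z\,g_kq_{k-1}\qquad(1\le k\le N).$$ The spectrum is the set of zeros of $p_N$ and the Weyl function is $W=q_N/p_N$. Assume that the spectrum is simple, i.e. consists of $\lfloor N/2\rfloor=\deg p_N$ distinct complex numbers $\zeta_j$, $1\le j\le\lfloor N/2\rfloor$, that none of them lies on the negative real axis, and let $b_j,c\in\mathbb C$ be such that $$W(z)=c+\sum_{j=1}^{\lfloor N/2\rfloor}\frac{b_j}{\zeta_j-z}$$ for all $z$ outside the spectrum. Write $j'=N-j+1$, $e_j=1/|m_{j'}|^2$,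 $\mathbf e_{[1,k]}=\prod_{j=1}^k e_j$ and, for integers $k\ge1$, $l,p\ge0$ and $r\ge -1$, $$\Sigma_{k}^{(r,p)}=\sum_{\substack{J\subseteq\{1,\dots,\lfloor N/2\rfloor\}\\ |J|=r}}\frac{\prod_{i<j;\,i,j\in J}(\zeta_j-\zeta_i)^2\,\prod_{j\in J}\zeta_j^{\,p}\,\prod_{j\in J}b_j}{\prod_{i=1}^k\prod_{j\in J}(e_i+\zeta_j)}$$ (an empty sum is $0$, an empty product is $1$). Let $\mathcal D_0^{(l,p)}=1$ and, for $k\ge 1$, $$\mathcal D_k^{(l,p)}=\prod_{1\le i<j\le k}(e_j-e_i)\cdot\begin{cases}\Sigma_k^{(l,p)}, & c=0\ \text{or}\ p+l-1<k-l,\\ \Sigma_k^{(l,p)}+c\,\Sigma_k^{(l-1,p)}, & c\ne0\ \text{and}\ p+l-1=k-l.\end{cases}$$ Then for every $1\le k\le N$ all the quantities $\mathcal D$ occurring below are non-zero, and, if $k$ is odd, $$x_{k'}=\ln\frac{\mathbf e_{[1,k-1]}\,|\mathcal D_k^{(\frac{k+1}2,0)}|\,|\mathcal D_{k-1}^{(\frac{k-1}2,0)}|}{|m_{k'}|\,|\mathcal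 D_k^{(\frac{k-1}2,1)}|\,|\mathcal D_{k-1}^{(\frac{k-1}2,1)}|},\qquad e^{i\omega_{k'}}=\frac{\mathcal D_k^{(\frac{k+1}2,0)}\mathcal D_{k-1}^{(\frac{k-1}2,0)}}{\mathcal D_k^{(\frac{k-1}2,1)}\mathcal D_{k-1}^{(\frac{k-1}2,1)}}\cdot\frac{|\mathcal D_k^{(\frac{k-1}2,1)}|\,|\mathcal D_{k-1}^{(\frac{k-1}2,1)}|}{|\mathcal D_k^{(\frac{k+1}2,0)}|\,|\mathcal D_{k-1}^{(\frac{k-1}2,0)}|},$$ while, if $k$ is even, $$x_{k'}=\ln\frac{\mathbf e_{[1,k-1]}\,|\mathcal D_k^{(\frac k2,0)}|\,|\mathcal D_{k-1}^{(\frac k2,0)}|}{|m_{k'}|\,|\mathcal D_k^{(\frac k2,1)}|\,|\mathcal D_{k-1}^{(\frac k2-1,1)}|},\qquad e^{i\omega_{k'}}=\frac{\mathcal D_k^{(\frac k2,0)}\mathcal D_{k-1}^{(\frac k2,0)}}{\mathcal D_k^{(\frac k2,1)}\mathcal D_{k-1}^{(\frac k2-1,1)}}\cdot\frac{|\mathcal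 D_k^{(\frac k2,1)}|\,|\mathcal D_{k-1}^{(\frac k2-1,1)}|}{|\mathcal D_k^{(\frac k2,0)}|\,|\mathcal D_{k-1}^{(\frac k2,0)}|}.$$ -/

import Mathlib

open Polynomial

noncomputable section

/-- An `N`-peakon configuration: positions `x 1 < ⋯ < x N`, phases `ω j` and moduli `absm j = |m_j| > 0`,
for `1 ≤ j ≤ N`. It encodes the discrete measure `m = 2 ∑ j, |m_j| e^{i ω_j} δ_{x_j}`.
Values of the fields at indices outside `1, …, N` play no role. -/
structure PeakonConfig (N : ℕ) where
  x : ℕ → ℝ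
  ω : ℕ → ℝ
  absm : ℕ → ℝ
  ordered : StrictMonoOn x (Set.Icc 1 N)
  absm_pos : ∀ j ∈ Set.Icc 1 N, 0 < absm j

namespace PeakonConfig

variable {N : ℕ} (P : PeakonConfig N)

/-- The complex amplitude `m_j = |m_j| e^{i ω_j}`. -/
def m (j : ℕ) : ℂ := (P.absm j : ℂ) * Complex.exp (Complex.I * (P.ω j : ℂ))

/-- The weight `g_j = conj m_j * e^{-x_j}`. -/
def g (j : ℕ) : ℂ := (starRingEnd ℂ) (P.m j) * Complex.exp (-(P.x j : ℂ))

/-- The weight `h_j = m_j * e^{x_j}`. -/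
def h (j : ℕ) : ℂ := P.m j * Complex.exp (P.x j : ℂ)

/-- The pair `(q_k, p_k)` of polynomials in the spectral variable `z` solving
`q_k - q_{k-1} = h_k p_{k-1}`, `p_k - p_{k-1} = - z g_k q_{k-1}`, `q_0 = 0`, `p_0 = 1`. -/
def qp : ℕ → ℂ[X] × ℂ[X]
  | 0 => (0, 1)
  | k + 1 => ((qp k).1 + C (P.h (k + 1)) * (qp k).2,
      (qp k).2 - X * C (P.g (k + 1)) * (qp k).1)

def q (k : ℕ) : ℂ[X] := (P.qp k).1

def p (k : ℕ) : ℂ[X] := (P.qp k).2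

/-- The spectrum of the boundary value problem: the solution of the initial value problem
satisfies `p_N(z) = 0`. -/
def spectrum : Set ℂ := {z | (P.p N).eval z = 0}

/-- The Weyl function `W(z) = q_N(z) / p_N(z)`, meaningful off the spectrum. -/
def weyl (z : ℂ) : ℂ := (P.q N).eval z / (P.p N).eval z

/-- `ζ_j, b_j` (`1 ≤ j ≤ ⌊N/2⌋`) and `c` are the spectral data of a configuration with simple
spectrum: the `ζ_j` are distinct and enumerate the spectrum (since `p_N` has degree `⌊N/2⌋` in `z`,
this says that all its zeros are simple), and `W(z) = c + ∑ j, b_j / (ζ_j - z)`. -/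
structure IsSpectralData (ζ b : ℕ → ℂ) (c : ℂ) : Prop where
  injOn : Set.InjOn ζ (Set.Icc 1 (N / 2))
  spectrum_eq : P.spectrum = ζ '' Set.Icc 1 (N / 2)
  weyl_eq : ∀ z, z ∉ P.spectrum → P.weyl z = c + ∑ j ∈ Finset.Icc 1 (N / 2), b j / (ζ j - z)

/-- `e_j = 1 / |m_{j'}|²` with `j' = N - j + 1`. -/
def e (j : ℕ) : ℝ := 1 / P.absm (N - j + 1) ^ 2

/-- `e_{[1,k]} = e_1 ⋯ e_k`. -/
def eProd (k : ℕ) : ℝ := ∏ j ∈ Finset.Icc 1 k, P.e j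

end PeakonConfig

/-- `Δ_J(y) = ∏_{i < j, i ∈ J, j ∈ J} (y_j - y_i)`. -/
def vandermondeOn (J : Finset ℕ) (y : ℕ → ℂ) : ℂ :=
  ∏ j ∈ J, ∏ i ∈ J with i < j, (y j - y i)

/-- `Γ_{I,J}(x; y) = ∏_{i ∈ I} ∏_{j ∈ J} (x_i + y_j)`. -/
def gammaOn (I J : Finset ℕ) (x y : ℕ → ℂ) : ℂ :=
  ∏ i ∈ I, ∏ j ∈ J, (x i + y j)

/-- The summand `Δ_J(ζ)² (ζ_J)^p b_J / Γ_{[1,k],J}(e; ζ)`. -/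
def cauchyTerm (e ζ b : ℕ → ℂ) (k p : ℕ) (J : Finset ℕ) : ℂ :=
  vandermondeOn J ζ ^ 2 * (∏ j ∈ J, ζ j) ^ p * (∏ j ∈ J, b j) /
    gammaOn (Finset.Icc 1 k) J e ζ

/-- The quantity `𝒟_k^{(l,p)}` built from the nodes `e`, the data `ζ_j, b_j` (`1 ≤ j ≤ K`) and `c`.
It is only used when `c = 0` or `p + l - 1 ≤ k - l`; the value `0` in the remaining case is arbitrary.
The second sum of the third case runs over the `J` with `l - 1` elements (none if `l = 0`). -/
def detD (K : ℕ) (e ζ b : ℕ → ℂ) (c : ℂ) (k l p : ℕ) : ℂ :=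
  if k = 0 then 1
  else if c = 0 ∨ (p : ℤ) + l - 1 < (k : ℤ) - l then
    vandermondeOn (Finset.Icc 1 k) e *
      ∑ J ∈ (Finset.Icc 1 K).powerset with J.card = l, cauchyTerm e ζ b k p J
  else if (p : ℤ) + l - 1 = (k : ℤ) - l then
    vandermondeOn (Finset.Icc 1 k) e *
      ((∑ J ∈ (Finset.Icc 1 K).powerset with J.card = l, cauchyTerm e ζ b k p J) +
        c * ∑ J ∈ (Finset.Icc 1 K).powerset with J.card + 1 = l, cauchyTerm e ζ b k p J)
  else 0

/-- `𝒟_k^{(l,p)}` for a peakon configuration: nodes `e_j = 1 / |m_{j'}|²` and `K = ⌊N/2⌋`. -/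
def PeakonConfig.D {N : ℕ} (P : PeakonConfig N) (ζ b : ℕ → ℂ) (c : ℂ) (k l p : ℕ) : ℂ :=
  detD (N / 2) (fun j => (P.e j : ℂ)) ζ b c k l p

end

/-! The last `k` steps of the recursion form a product of matrices
$\begin{pmatrix}1&h\\-zg&1\end{pmatrix}$ with determinants $1+zgh=1+z|m|^2$. At $z=-e_1,\dots,-e_k$
the product is singular, so $W=q_N/p_N$ agrees there with a ratio of entries that depends only on
the last `k` peakons. This is a Cauchy–Jacobi interpolation problem with exactly as many unknown
coefficients as nodes; no node is a pole of $W$, since the spectrum avoids the negative axis.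

Its solution is written in Hankel determinants of the moments of $f\mapsto[-e_1,\dots,-e_k](Wf)$, a
divided difference. Partial fractions of $W$ make these the moments of a discrete measure at the
$\zeta_j$, plus $c$ in the moment of order $k-1$; Cauchy–Binet then turns the determinants into
$\mathcal D_k^{(l,p)}$ (`detD_eq_det_hankel`). Hence $\mathcal
D_k^{(\lfloor(k+1)/2\rfloor,0)}/\mathcal D_k^{(\lfloor k/2\rfloor,1)}$ is, up to sign, a top
coefficient of the interpolating fraction (`det_hankel_transferRow`); the denominator is non-zero
because the two rows of the product give complementary solutions (`det_hankel_ne_zero`). Consecutive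
top coefficients multiply to $h_{k'}/\mathbf e_{[1,k-1]}$ (`topCoeff_succ_mul`), and $x_{k'}$,
$\omega_{k'}$ are read off from modulus and argument. -/

open Polynomial

noncomputable section

/-! ### Hankel determinants of discrete measures. -/

/-- The Hankel matrix `(μ (i + j + p))` of size `l`. -/
def hankel (μ : ℕ → ℂ) (l p : ℕ) : Matrix (Fin l) (Fin l) ℂ :=
  Matrix.of fun i j => μ (i + j + p)

theorem vandermondeOn_eq_det {n : ℕ} (J : Finset ℕ) (hJ : J.card = n) (y : ℕ → ℂ) :
    vandermondeOn J y = (Matrix.vandermonde fun i => y (J.orderEmbOfFin hJ i)).det := by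
  rw [Matrix.det_vandermonde, vandermondeOn]
  conv_lhs => rw [← Finset.map_orderEmbOfFin_univ J hJ]
  simp only [Finset.prod_map, Finset.filter_map]
  rw [Finset.prod_comm' (t' := Finset.univ) (s' := fun i => Finset.Ioi i)]
  · rfl
  · intro x y
    simp

theorem vandermondeOn_ne_zero {J : Finset ℕ} {y : ℕ → ℂ} (hy : Set.InjOn y J) :
    vandermondeOn J y ≠ 0 := by
  refine Finset.prod_ne_zero_iff.2 fun j hj => Finset.prod_ne_zero_iff.2 fun i hi => ?_
  rw [Finset.mem_filter] at hi
  rw [sub_ne_zero]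
  intro h
  exact hi.2.ne (hy (by simpa using hi.1) (by simpa using hj) h.symm)

/-- A sum over all maps `Fin n → s` whose summand vanishes at non-injective maps, reorganised
by images. -/
theorem sum_piFinset_eq_sum_powersetCard {n : ℕ} (s : Finset ℕ) (F : (Fin n → ℕ) → ℂ)
    (hF : ∀ f, ¬ Function.Injective f → F f = 0) (G : Finset ℕ → ℂ)
    (hG : ∀ J (hJ : J.card = n),
      ∑ σ : Equiv.Perm (Fin n), F (fun i => J.orderEmbOfFin hJ (σ i)) = G J) :
    ∑ f ∈ Fintype.piFinset (fun _ : Fin n => s), F f = ∑ J ∈ s.powersetCard n, G J := by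
  classical
  rw [← Finset.sum_filter_of_ne (p := Function.Injective)
    (fun f _ h => not_imp_comm.1 (hF f) h)]
  rw [← Finset.sum_fiberwise_of_maps_to (t := s.powersetCard n)
    (g := fun f => Finset.univ.image f)]
  · refine Finset.sum_congr rfl fun J hJ => ?_
    obtain ⟨hJs, hJc⟩ := Finset.mem_powersetCard.1 hJ
    rw [← hG J hJc]
    symm
    refine Finset.sum_nbij (fun σ i => J.orderEmbOfFin hJc (σ i)) ?_ ?_ ?_ (fun _ _ => rfl)
    · intro σ _
      simp only [Finset.mem_filter, Fintype.mem_piFinset]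
      refine ⟨⟨fun i => hJs (J.orderEmbOfFin_mem hJc _),
        (J.orderEmbOfFin hJc).injective.comp σ.injective⟩, ?_⟩
      refine Eq.trans ?_ (Finset.image_orderEmbOfFin_univ J hJc)
      ext x
      simp only [Finset.mem_image, Finset.mem_univ, true_and]
      exact ⟨fun ⟨i, h⟩ => ⟨σ i, h⟩, fun ⟨i, h⟩ => ⟨σ.symm i, by simpa using h⟩⟩
    · intro σ _ τ _ h
      refine Equiv.ext fun i => ?_
      have := congrFun h i
      simpa using this
    · intro f hf
      simp only [Finset.coe_filter, Set.mem_ofPred_eq, Finset.mem_filter] at hf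
      obtain ⟨⟨-, hinj⟩, him⟩ := hf
      have hmem : ∀ i, f i ∈ J := fun i => him ▸ Finset.mem_image_of_mem f (Finset.mem_univ i)
      let τ : Fin n → Fin n := fun i => (J.orderIsoOfFin hJc).symm ⟨f i, hmem i⟩
      have hτ : Function.Injective τ := by
        intro i j hij
        exact hinj (by simpa [τ] using hij)
      refine ⟨Equiv.ofBijective τ (Finite.injective_iff_bijective.1 hτ), by simp, ?_⟩
      funext i
      simp [τ, ← Finset.coe_orderIsoOfFin_apply]
  · intro f hf
    simp only [Finset.mem_filter, Fintype.mem_piFinset] at hf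
    rw [Finset.mem_powersetCard]
    refine ⟨fun x hx => ?_, ?_⟩
    · obtain ⟨i, -, rfl⟩ := Finset.mem_image.1 hx
      exact hf.1 i
    · rw [Finset.card_image_of_injective _ hf.2]; simp

/-- Hankel determinants of a discrete measure (a case of the Cauchy–Binet formula). -/
theorem det_hankel_discrete (s : Finset ℕ) (w ζ : ℕ → ℂ) (n p : ℕ) :
    (hankel (fun m => ∑ t ∈ s, w t * ζ t ^ m) n p).det =
      ∑ J ∈ s.powersetCard n, vandermondeOn J ζ ^ 2 * ∏ t ∈ J, (w t * ζ t ^ p) := by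
  have hV (f : Fin n → ℕ) : (Matrix.vandermonde fun i => ζ (f i)).det =
      ∑ σ : Equiv.Perm (Fin n), (Equiv.Perm.sign σ : ℂ) * ∏ i, ζ (f i) ^ (σ i : ℕ) := by
    rw [← Matrix.det_transpose, Matrix.det_apply']
    rfl
  -- Expanding the entries gives a sum over choices `f` of one atom per column. The sum over
  -- permutations `σ` makes a Vandermonde determinant, which kills non-injective `f`; permuting the
  -- atoms of a fixed image `J` produces the second Vandermonde factor.
  rw [← sum_piFinset_eq_sum_powersetCard s
    (fun f => (∏ i, w (f i) * ζ (f i) ^ p * ζ (f i) ^ (i : ℕ)) *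
      (Matrix.vandermonde fun i => ζ (f i)).det)]
  · rw [Matrix.det_apply']
    simp only [hV, hankel, Matrix.of_apply, Finset.prod_univ_sum, Finset.mul_sum]
    rw [Finset.sum_comm]
    refine Finset.sum_congr rfl fun f _ => Finset.sum_congr rfl fun σ _ => ?_
    rw [mul_left_comm, ← Finset.prod_mul_distrib]
    congr 1
    refine Finset.prod_congr rfl fun i _ => ?_
    ring
  · intro f hf
    rw [Matrix.det_vandermonde_eq_zero_iff.2, mul_zero]
    rw [Function.Injective] at hf
    push Not at hf
    obtain ⟨i, j, h, hne⟩ := hf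
    exact ⟨i, j, by rw [h], hne⟩
  · intro J hJ
    have h1 (σ : Equiv.Perm (Fin n)) :
        (Matrix.vandermonde fun i => ζ (J.orderEmbOfFin hJ (σ i))).det =
          (Equiv.Perm.sign σ : ℂ) * vandermondeOn J ζ := by
      rw [vandermondeOn_eq_det J hJ, ← Matrix.det_permute]
      rfl
    have h2 (σ : Equiv.Perm (Fin n)) :
        ∏ i, (w (J.orderEmbOfFin hJ (σ i)) * ζ (J.orderEmbOfFin hJ (σ i)) ^ p *
            ζ (J.orderEmbOfFin hJ (σ i)) ^ (i : ℕ)) =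
          (∏ t ∈ J, (w t * ζ t ^ p)) * ∏ i, ζ (J.orderEmbOfFin hJ (σ i)) ^ (i : ℕ) := by
      rw [Finset.prod_mul_distrib]
      congr 1
      rw [Equiv.prod_comp σ fun i => w (J.orderEmbOfFin hJ i) * ζ (J.orderEmbOfFin hJ i) ^ p]
      conv_rhs => rw [← Finset.map_orderEmbOfFin_univ J hJ]
      rw [Finset.prod_map]
      rfl
    have h3 : vandermondeOn J ζ = ∑ σ : Equiv.Perm (Fin n),
        (Equiv.Perm.sign σ : ℂ) * ∏ i, ζ (J.orderEmbOfFin hJ (σ i)) ^ (i : ℕ) := by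
      rw [vandermondeOn_eq_det J hJ, Matrix.det_apply']
      rfl
    simp only [h1, h2]
    rw [sq]
    conv_rhs => rw [mul_assoc, mul_comm, h3, Finset.sum_mul, Finset.sum_mul]
    rw [← h3]
    refine Finset.sum_congr rfl fun σ _ => ?_
    ring

/-- Perturbing the last moment of a Hankel determinant. -/
theorem det_hankel_add_single (μ : ℕ → ℂ) (l p M : ℕ) (hM : 2 * l + p = M) (c : ℂ) :
    (hankel (fun n => μ n + if n = M then c else 0) (l + 1) p).det =
      (hankel μ (l + 1) p).det + c * (hankel μ l p).det := by
  -- Only the bottom right entry has index `M = 2 * l + p`, so the perturbation is a multiple of a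
  -- unit vector added to the last row.
  have h : hankel (fun n => μ n + if n = M then c else 0) (l + 1) p =
      (hankel μ (l + 1) p).updateRow (Fin.last l)
        (hankel μ (l + 1) p (Fin.last l) + c • Pi.single (Fin.last l) 1) := by
    ext i j
    rcases eq_or_ne i (Fin.last l) with rfl | hi
    · rw [Matrix.updateRow_self]
      simp only [hankel, Matrix.of_apply, Pi.add_apply, Pi.smul_apply, Fin.val_last,
        Pi.single_apply, smul_eq_mul]
      congr 1
      rcases eq_or_ne j (Fin.last l) with rfl | hj
      · rw [if_pos (by simp; omega), if_pos rfl, mul_one]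
      · have := Fin.val_lt_last hj
        rw [if_neg (by omega), if_neg hj, mul_zero]
    · have := Fin.val_lt_last hi
      rw [Matrix.updateRow_ne hi]
      simp only [hankel, Matrix.of_apply]
      rw [if_neg (by omega), add_zero]
  rw [h, Matrix.det_updateRow_add, Matrix.det_updateRow_smul, Matrix.updateRow_eq_self]
  congr 2
  rw [Matrix.det_succ_row _ (Fin.last l), Finset.sum_eq_single (Fin.last l)]
  · simp only [Fin.val_last, Matrix.updateRow_self, Pi.single_eq_same, mul_one,
      Matrix.submatrix_updateRow_succAbove]
    rw [Even.neg_one_pow ⟨l, rfl⟩, one_mul]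
    congr 1
    ext i j
    simp [hankel, Fin.succAbove_last]
  · intro j _ hj
    simp [hj]
  · simp

theorem hankel_congr {μ ν : ℕ → ℂ} {l p : ℕ} (h : ∀ n, n + 2 ≤ 2 * l + p → μ n = ν n) :
    hankel μ l p = hankel ν l p := by
  ext i j
  exact h _ (by have := i.2; have := j.2; omega)

/-! ### Divided differences and their moments. -/

/-- The divided difference of `W f` at the nodes `x i`, `i ∈ s`, as a functional of `f`. -/
def dividedDiff (s : Finset ℕ) (x W : ℕ → ℂ) (f : ℂ[X]) : ℂ :=
  ∑ i ∈ s, Lagrange.nodalWeight s x i * (W i * f.eval (x i))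

/-- A divided difference sees only values at the nodes, so `W f` may be replaced by an interpolating
polynomial, on which it reads off the top admissible coefficient. -/
theorem dividedDiff_eq_coeff {s : Finset ℕ} {x W : ℕ → ℂ} (hx : Set.InjOn x s) {f g : ℂ[X]}
    (hfg : ∀ i ∈ s, W i * f.eval (x i) = g.eval (x i)) (hg : g.degree < s.card) :
    dividedDiff s x W f = g.coeff (s.card - 1) := by
  rw [Lagrange.coeff_eq_sum hx hg, dividedDiff]
  refine Finset.sum_congr rfl fun i hi => ?_
  rw [hfg i hi, Lagrange.nodalWeight, Finset.prod_inv_distrib, div_eq_inv_mul]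

theorem dividedDiff_mul_X_pow (s : Finset ℕ) (x W : ℕ → ℂ) {f : ℂ[X]} {l : ℕ}
    (hf : f.degree < l) (j : ℕ) :
    dividedDiff s x W (f * X ^ j) =
      ∑ n ∈ Finset.range l, f.coeff n * dividedDiff s x W (X ^ (n + j)) := by
  simp only [dividedDiff, Finset.mul_sum]
  rw [Finset.sum_comm]
  refine Finset.sum_congr rfl fun i _ => ?_
  have h : f.eval (x i) = ∑ n ∈ Finset.range l, f.coeff n * x i ^ n := by
    rcases eq_or_ne f 0 with rfl | h0
    · simp
    · exact eval_eq_sum_range' ((natDegree_lt_iff_degree_lt h0).2 hf) _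
  rw [eval_mul, h, Finset.sum_mul, Finset.mul_sum, Finset.mul_sum]
  refine Finset.sum_congr rfl fun n _ => ?_
  simp only [eval_pow, eval_X]
  ring

/-- Partial fractions: the moments of the divided difference functional of a rational function
with simple poles. -/
theorem dividedDiff_X_pow_of_partialFraction {s S : Finset ℕ} {x W ζ b : ℕ → ℂ} {c : ℂ}
    (hx : Set.InjOn x s) (hζ : ∀ t ∈ S, ∀ i ∈ s, ζ t ≠ x i)
    (hW : ∀ i ∈ s, W i = c + ∑ t ∈ S, b t / (ζ t - x i)) {n : ℕ} (hn : n < s.card) :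
    dividedDiff s x W (X ^ n) =
      ∑ t ∈ S, b t / (Lagrange.nodal s x).eval (ζ t) * ζ t ^ n +
        if n = s.card - 1 then c else 0 := by
  have hdeg : (X ^ n : ℂ[X]).degree < s.card := by
    rw [degree_X_pow]; exact_mod_cast hn
  have h1 : ∑ i ∈ s, Lagrange.nodalWeight s x i * (c * x i ^ n) =
      if n = s.card - 1 then c else 0 := by
    have := dividedDiff_eq_coeff (W := fun _ => c) hx (f := X ^ n) (g := C c * X ^ n)
      (fun i _ => by simp) ((degree_C_mul_X_pow_le n c).trans_lt (by exact_mod_cast hn))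
    simp only [dividedDiff, eval_pow, eval_X, coeff_C_mul_X_pow] at this
    simp only [this, eq_comm]
  -- Barycentric formula for `X ^ n`, which is its own interpolant because `n < s.card`, evaluated
  -- at the pole `ζ t`.
  have h2 (t) (ht : t ∈ S) : ζ t ^ n / (Lagrange.nodal s x).eval (ζ t) =
      ∑ i ∈ s, Lagrange.nodalWeight s x i * (ζ t - x i)⁻¹ * x i ^ n := by
    have h0 := Lagrange.eval_nodal_not_at_node (hζ t ht)
    have h3 := Lagrange.eval_interpolate_not_at_node (fun i => x i ^ n) (hζ t ht)
    rw [← Lagrange.eq_interpolate_of_eval_eq (fun i => x i ^ n) hx hdeg (by simp)] at h3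
    rw [div_eq_iff h0, mul_comm, ← h3]
    simp
  rw [← h1, dividedDiff]
  have h4 : ∑ t ∈ S, b t / (Lagrange.nodal s x).eval (ζ t) * ζ t ^ n =
      ∑ i ∈ s, ∑ t ∈ S, b t * (Lagrange.nodalWeight s x i * (ζ t - x i)⁻¹ * x i ^ n) := by
    rw [Finset.sum_comm]
    refine Finset.sum_congr rfl fun t ht => ?_
    rw [← Finset.mul_sum, ← h2 t ht]
    ring
  rw [h4, ← Finset.sum_add_distrib]
  refine Finset.sum_congr rfl fun i hi => ?_
  rw [hW i hi, eval_pow, eval_X, add_mul, mul_add, add_comm, Finset.sum_mul, Finset.mul_sum]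
  congr 1
  refine Finset.sum_congr rfl fun t _ => ?_
  ring

/-! ### Cauchy–Jacobi interpolation and Hankel determinants. -/

theorem degree_mul_lt_of_degree_lt {f g : ℂ[X]} {a b k : ℕ} (hf : f.degree < a)
    (hg : g.degree < b) (h : a + b ≤ k + 1) : (f * g).degree < k := by
  rcases eq_or_ne f 0 with rfl | hf0
  · simp [bot_lt_iff_ne_bot]
  rcases eq_or_ne g 0 with rfl | hg0
  · simp [bot_lt_iff_ne_bot]
  rw [← natDegree_lt_iff_degree_lt (mul_ne_zero hf0 hg0), natDegree_mul hf0 hg0]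
  rw [← natDegree_lt_iff_degree_lt hf0] at hf
  rw [← natDegree_lt_iff_degree_lt hg0] at hg
  omega

theorem degree_X_mul_lt {f : ℂ[X]} {a : ℕ} (hf : f.degree < a) :
    ((X : ℂ[X]) * f).degree < ((a + 1 : ℕ) : WithBot ℕ) :=
  degree_mul_lt_of_degree_lt (k := a + 1) (a := 2) (b := a)
    (by rw [degree_X]; exact_mod_cast one_lt_two) hf (by omega)

/-- If the divided differences of `W d X ^ j` vanish for `j < l`, then the interpolant of `W d`
has degree less than `k - l`. -/
theorem degree_interpolate_lt_of_dividedDiff_eq_zero {s : Finset ℕ} {x W : ℕ → ℂ}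
    (hx : Set.InjOn x s) {d : ℂ[X]} {l r : ℕ} (hlr : s.card ≤ l + r)
    (hd : ∀ j < l, dividedDiff s x W (d * X ^ j) = 0) :
    (Lagrange.interpolate s x fun i => W i * d.eval (x i)).degree < r := by
  set b := Lagrange.interpolate s x fun i => W i * d.eval (x i) with hb
  by_contra hr
  have hb0 : b ≠ 0 := fun h => hr (by simp [h, bot_lt_iff_ne_bot])
  have hk : b.natDegree < s.card :=
    (natDegree_lt_iff_degree_lt hb0).2 (Lagrange.degree_interpolate_lt _ hx)
  rw [← natDegree_lt_iff_degree_lt hb0] at hr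
  -- This power of `X` moves the leading term of `b` to degree `s.card - 1`, the one a divided
  -- difference detects.
  have h0 := hd (s.card - 1 - b.natDegree) (by omega)
  rw [dividedDiff_eq_coeff hx (g := b * X ^ (s.card - 1 - b.natDegree))] at h0
  · rw [coeff_mul_X_pow', if_pos (by omega), Nat.sub_sub_self (by omega)] at h0
    exact hb0 (leadingCoeff_eq_zero.1 h0)
  · intro i hi
    rw [eval_mul, eval_mul, ← mul_assoc, hb, Lagrange.eval_interpolate_at_node _ hx hi]
  · rw [← natDegree_lt_iff_degree_lt (mul_ne_zero hb0 (pow_ne_zero _ X_ne_zero)),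
      natDegree_mul hb0 (pow_ne_zero _ X_ne_zero), natDegree_X_pow]
    omega

/-- Two complementary solutions of a Cauchy–Jacobi interpolation problem force the determinant of
the problem to be non-zero. -/
theorem det_hankel_ne_zero {s : Finset ℕ} {x W : ℕ → ℂ} (hx : Set.InjOn x s)
    {p q p' q' : ℂ[X]} {k : ℕ} (hk : s.card = k)
    (hp : p.degree < (k / 2 + 1 : ℕ)) (hq : q.degree < ((k + 1) / 2 : ℕ))
    (hp' : p'.degree < (k / 2 + 1 : ℕ)) (hq' : q'.degree < ((k + 1) / 2 : ℕ))
    (hpq : ∀ i ∈ s, W i * p.eval (x i) = q.eval (x i))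
    (hpq' : ∀ i ∈ s, p'.eval (x i) = -(x i * q'.eval (x i) * W i))
    (hW : p' * p + X * (q * q') ≠ 0) :
    (hankel (fun n => dividedDiff s x W (X ^ n)) (k / 2) 1).det ≠ 0 := by
  intro hdet
  obtain ⟨v, hv0, hv⟩ := Matrix.exists_mulVec_eq_zero_iff.2 hdet
  -- A null vector of the Hankel matrix yields a nonzero `V` for which `W * X * V` has an
  -- interpolant `b` of low degree. Cross-multiplying with either solution gives a polynomial of
  -- degree less than `k` vanishing at all `k` nodes.
  set V : ℂ[X] := ∑ j : Fin (k / 2), C (v j) * X ^ (j : ℕ) with hV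
  have hVdeg : V.degree < (k / 2 : ℕ) := degree_sum_fin_lt v
  have hVcoeff (j : Fin (k / 2)) : V.coeff j = v j := by
    rw [hV, finsetSum_coeff, Finset.sum_eq_single j]
    · simp
    · intro i _ hij
      rw [coeff_C_mul_X_pow, if_neg]
      exact fun h => hij (Fin.ext h.symm)
    · simp
  have hmom (j) (hj : j < k / 2) : dividedDiff s x W (X * V * X ^ j) = 0 := by
    have h1 : X * V * X ^ j = V * X ^ (j + 1) := by ring
    rw [h1, dividedDiff_mul_X_pow s x W hVdeg, ← Fin.sum_univ_eq_sum_range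
      (fun n => V.coeff n * dividedDiff s x W (X ^ (n + (j + 1))))]
    have h2 := congrFun hv ⟨j, hj⟩
    simp only [Matrix.mulVec, dotProduct, hankel, Matrix.of_apply, Pi.zero_apply] at h2
    rw [← h2]
    refine Finset.sum_congr rfl fun n _ => ?_
    rw [hVcoeff, mul_comm, show (n : ℕ) + (j + 1) = j + n + 1 by ring]
  have hbdeg := degree_interpolate_lt_of_dividedDiff_eq_zero hx (r := (k + 1) / 2)
    (by omega) hmom
  have hbev (i) (hi : i ∈ s) := Lagrange.eval_interpolate_at_node
    (fun i => W i * (X * V).eval (x i)) hx hi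
  set b := Lagrange.interpolate s x fun i => W i * (X * V).eval (x i)
  have e1 : X * V * q - p * b = 0 := by
    refine eq_zero_of_degree_lt_of_eval_index_eq_zero s hx ?_ fun i hi => ?_
    · rw [hk]
      exact (degree_sub_le _ _).trans_lt (max_lt
        (degree_mul_lt_of_degree_lt (degree_X_mul_lt hVdeg) hq (by omega))
        (degree_mul_lt_of_degree_lt hp hbdeg (by omega)))
    · rw [eval_sub, eval_mul, eval_mul (p := p), hbev i hi, ← hpq i hi]
      ring
  have e2 : V * p' + b * q' = 0 := by
    refine eq_zero_of_degree_lt_of_eval_index_eq_zero s hx ?_ fun i hi => ?_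
    · rw [hk]
      exact (degree_add_le _ _).trans_lt (max_lt
        (degree_mul_lt_of_degree_lt hVdeg hp' (by omega))
        (degree_mul_lt_of_degree_lt hbdeg hq' (by omega)))
    · rw [eval_add, eval_mul, eval_mul (p := b), hbev i hi, hpq' i hi, eval_mul, eval_X]
      ring
  have e3 : V * (p' * p + X * (q * q')) = 0 := by
    linear_combination p * e2 + q' * e1
  rcases mul_eq_zero.1 e3 with h | h
  · refine hv0 (funext fun j => ?_)
    rw [← hVcoeff, h]
    simp
  · exact hW h

/-- Cramer's rule, in adjugate form so that `A` need not be invertible. -/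
theorem det_mul_eq_of_mulVec_eq_single {m : ℕ} (A : Matrix (Fin (m + 1)) (Fin (m + 1)) ℂ)
    {v : Fin (m + 1) → ℂ} {β : ℂ} (h : A.mulVec v = Pi.single (Fin.last m) β)
    (i : Fin (m + 1)) :
    A.det * v i = (-1) ^ (m + (i : ℕ)) *
      (A.submatrix (Fin.last m).succAbove i.succAbove).det * β := by
  have h1 : A.adjugate.mulVec (A.mulVec v) i = A.det * v i := by
    rw [Matrix.mulVec_mulVec, Matrix.adjugate_mul, Matrix.smul_mulVec, Matrix.one_mulVec]
    simp
  rw [← h1, h, Matrix.mulVec_single, Pi.smul_apply, Matrix.col_apply,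
    Matrix.adjugate_fin_succ_eq_det_submatrix]
  simp

/-- The top coefficient of the numerator of the interpolant, for an odd number of nodes. -/
theorem det_hankel_eq_coeff_numerator {s : Finset ℕ} {x W : ℕ → ℂ} (hx : Set.InjOn x s)
    {p q : ℂ[X]} {m : ℕ} (hk : s.card = 2 * m + 1) (hp : p.degree < (m + 1 : ℕ))
    (hq : q.degree < (m + 1 : ℕ)) (hp0 : p.coeff 0 = 1)
    (hpq : ∀ i ∈ s, W i * p.eval (x i) = q.eval (x i)) :
    (hankel (fun n => dividedDiff s x W (X ^ n)) (m + 1) 0).det =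
      (-1) ^ m * q.coeff m * (hankel (fun n => dividedDiff s x W (X ^ n)) m 1).det := by
  -- Row `j` computes the divided difference of `q * X ^ j`, the coefficient of `q` at `2 * m - j`;
  -- by degree it vanishes unless `j = m`. Cramer's rule at the coordinate `p.coeff 0 = 1` then
  -- suffices.
  have key : (hankel (fun n => dividedDiff s x W (X ^ n)) (m + 1) 0).mulVec
      (fun n => p.coeff n) = Pi.single (Fin.last m) (q.coeff m) := by
    ext j
    have hj := j.2
    have h1 := dividedDiff_mul_X_pow s x W hp j
    rw [dividedDiff_eq_coeff hx (g := q * X ^ (j : ℕ)), ← Fin.sum_univ_eq_sum_range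
      (fun n => p.coeff n * dividedDiff s x W (X ^ (n + (j : ℕ))))] at h1
    · simp only [Matrix.mulVec, dotProduct, hankel, Matrix.of_apply, add_zero]
      rw [Finset.sum_congr rfl fun n _ => by rw [mul_comm, add_comm (j : ℕ)], ← h1,
        coeff_mul_X_pow', if_pos (by omega)]
      rcases eq_or_ne j (Fin.last m) with rfl | hne
      · rw [Pi.single_eq_same, Fin.val_last]
        congr 1
        omega
      · have := Fin.val_lt_last hne
        rw [Pi.single_eq_of_ne hne]
        exact (degree_lt_iff_coeff_zero _ _).1 hq _ (by omega)
    · intro i hi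
      rw [eval_mul, eval_mul, ← mul_assoc, hpq i hi]
    · rw [hk]
      refine degree_mul_lt_of_degree_lt (b := m + 1) hq ?_ (by omega)
      rw [degree_X_pow]
      exact_mod_cast hj
  have h2 := det_mul_eq_of_mulVec_eq_single _ key 0
  simp only [Fin.val_zero, hp0, mul_one, add_zero] at h2
  rw [h2, mul_right_comm]
  congr 3
  ext i j
  simp [hankel, Fin.succAbove_last, add_assoc]

/-- The top coefficient of the denominator of the interpolant, for an even number of nodes. -/
theorem det_hankel_eq_coeff_denominator {s : Finset ℕ} {x W : ℕ → ℂ} (hx : Set.InjOn x s)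
    {p q : ℂ[X]} {m : ℕ} (hk : s.card = 2 * m) (hp : p.degree < (m + 1 : ℕ))
    (hq : q.degree < m) (hp0 : p.coeff 0 = 1)
    (hpq : ∀ i ∈ s, W i * p.eval (x i) = q.eval (x i)) :
    (hankel (fun n => dividedDiff s x W (X ^ n)) m 0).det =
      (-1) ^ m * p.coeff m * (hankel (fun n => dividedDiff s x W (X ^ n)) m 1).det := by
  set H := hankel (fun n => dividedDiff s x W (X ^ n)) (m + 1) 0 with hH
  -- The interpolation conditions fill only the first `m` rows; the last row is replaced by the
  -- normalisation `p.coeff 0 = 1`. Cramer's rule at the first and last coordinates gives the two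
  -- Hankel minors.
  have key : (H.updateRow (Fin.last m) (Pi.single 0 1)).mulVec
      (fun n => p.coeff n) = Pi.single (Fin.last m) 1 := by
    ext j
    rcases eq_or_ne j (Fin.last m) with rfl | hne
    · rw [Matrix.mulVec, Matrix.updateRow_self, Pi.single_eq_same, single_dotProduct]
      simp [hp0]
    have hj := Fin.val_lt_last hne
    have h1 := dividedDiff_mul_X_pow s x W hp j
    rw [dividedDiff_eq_coeff hx (g := q * X ^ (j : ℕ)), ← Fin.sum_univ_eq_sum_range
      (fun n => p.coeff n * dividedDiff s x W (X ^ (n + (j : ℕ))))] at h1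
    · rw [Matrix.mulVec, Matrix.updateRow_ne hne, Pi.single_eq_of_ne hne]
      simp only [dotProduct, hH, hankel, Matrix.of_apply, add_zero]
      rw [Finset.sum_congr rfl fun n _ => by rw [mul_comm, add_comm (j : ℕ)], ← h1,
        coeff_mul_X_pow', if_pos (by omega)]
      exact (degree_lt_iff_coeff_zero _ _).1 hq _ (by omega)
    · intro i hi
      rw [eval_mul, eval_mul, ← mul_assoc, hpq i hi]
    · rw [hk]
      refine degree_mul_lt_of_degree_lt (b := m) hq ?_ (by omega)
      rw [degree_X_pow]
      exact_mod_cast hj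
  have h2 := det_mul_eq_of_mulVec_eq_single _ key 0
  have h3 := det_mul_eq_of_mulVec_eq_single _ key (Fin.last m)
  rw [Matrix.submatrix_updateRow_succAbove] at h2 h3
  have e2 : H.submatrix (Fin.last m).succAbove (Fin.succAbove 0) =
      hankel (fun n => dividedDiff s x W (X ^ n)) m 1 := by
    ext i j
    simp [hH, hankel, Fin.succAbove_last, add_assoc]
  have e3 : H.submatrix (Fin.last m).succAbove (Fin.last m).succAbove =
      hankel (fun n => dividedDiff s x W (X ^ n)) m 0 := by
    ext i j
    simp [hH, hankel, Fin.succAbove_last]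
  rw [e2] at h2
  rw [e3, Fin.val_last, Even.neg_one_pow ⟨m, rfl⟩] at h3
  simp only [Fin.val_zero, hp0, mul_one, add_zero] at h2
  rw [one_mul, mul_one, h2] at h3
  rw [← h3]
  ring

/-! ### Transfer matrices and their top coefficients. -/

/-- A row of the product of the first `k` transfer matrices with weights `g`, `h`. -/
def transferRow (g h : ℕ → ℂ) : ℕ → ℂ[X] × ℂ[X]
  | 0 => (1, 0)
  | k + 1 => ((transferRow g h k).1 - X * (C (g k) * (transferRow g h k).2),
      (transferRow g h k).2 + C (h k) * (transferRow g h k).1)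

/-- The two bounds allow `k + 1` coefficients in all; the normalisation of the constant term leaves
`k` unknowns, one per node. -/
theorem degree_transferRow (g h : ℕ → ℂ) (k : ℕ) :
    (transferRow g h k).1.degree < (k / 2 + 1 : ℕ) ∧
      (transferRow g h k).2.degree < ((k + 1) / 2 : ℕ) := by
  have hC (c : ℂ) (f : ℂ[X]) (n : ℕ) (hf : f.degree < n) : (C c * f).degree < n :=
    (smul_eq_C_mul (p := f) c ▸ degree_smul_le c f).trans_lt hf
  have mono {f : ℂ[X]} {m n : ℕ} (hf : f.degree < m) (hmn : m ≤ n) : f.degree < n :=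
    hf.trans_le (by exact_mod_cast hmn)
  induction k with
  | zero => simp [transferRow]
  | succ k ih =>
    refine ⟨(degree_sub_le _ _).trans_lt (max_lt (mono ih.1 (by omega))
      (degree_X_mul_lt (hC _ _ _ ih.2))), (degree_add_le _ _).trans_lt
      (max_lt (mono ih.2 (by omega)) (mono (hC _ _ _ ih.1) (by omega)))⟩

theorem coeff_zero_transferRow (g h : ℕ → ℂ) (k : ℕ) :
    (transferRow g h k).1.coeff 0 = 1 := by
  induction k with
  | zero => simp [transferRow]
  | succ k ih => simp [transferRow, ih]

/-- Multiplicativity of the determinant: swapping `g` and `h` gives the other row, up to order and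
the factor `-X`. -/
theorem transferRow_det (g h : ℕ → ℂ) (k : ℕ) :
    (transferRow g h k).1 * (transferRow h g k).1 +
      X * ((transferRow g h k).2 * (transferRow h g k).2) =
      ∏ i ∈ Finset.range k, (1 + X * C (g i * h i)) := by
  induction k with
  | zero => simp [transferRow]
  | succ k ih =>
    rw [Finset.prod_range_succ, ← ih, C_mul]
    simp only [transferRow]
    ring

theorem coeff_fst_transferRow_succ (g h : ℕ → ℂ) (m : ℕ) :
    (transferRow g h (2 * m + 2)).1.coeff (m + 1) =
      -(g (2 * m + 1) * (transferRow g h (2 * m + 1)).2.coeff m) := by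
  have h0 : (transferRow g h (2 * m + 1)).1.coeff (m + 1) = 0 :=
    (degree_lt_iff_coeff_zero _ _).1 (degree_transferRow g h (2 * m + 1)).1 _ (by omega)
  rw [transferRow, coeff_sub, h0, coeff_X_mul, coeff_C_mul, zero_sub]

theorem coeff_snd_transferRow_succ (g h : ℕ → ℂ) (m : ℕ) :
    (transferRow g h (2 * m + 1)).2.coeff m =
      h (2 * m) * (transferRow g h (2 * m)).1.coeff m := by
  have h0 : (transferRow g h (2 * m)).2.coeff m = 0 :=
    (degree_lt_iff_coeff_zero _ _).1 (degree_transferRow g h (2 * m)).2 _ (by omega)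
  rw [transferRow, coeff_add, h0, coeff_C_mul, zero_add]

theorem coeff_fst_transferRow_mul (g h : ℕ → ℂ) (m : ℕ) :
    (transferRow g h (2 * m)).1.coeff m * (transferRow h g (2 * m)).1.coeff m =
      ∏ i ∈ Finset.range (2 * m), g i * h i := by
  induction m with
  | zero => simp [transferRow]
  | succ m ih =>
    rw [show 2 * (m + 1) = 2 * m + 2 by ring, coeff_fst_transferRow_succ,
      coeff_fst_transferRow_succ, coeff_snd_transferRow_succ, coeff_snd_transferRow_succ,
      Finset.prod_range_succ, Finset.prod_range_succ, ← ih]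
    ring

/-- The signed top coefficient of the interpolating fraction `(transferRow g h k).2 /
(transferRow h g k).1`: of the numerator for odd `k`, of the denominator for even `k`. -/
def topCoeff (g h : ℕ → ℂ) (k : ℕ) : ℂ :=
  (-1) ^ (k / 2) * if Even k then (transferRow h g k).1.coeff (k / 2)
    else (transferRow g h k).2.coeff (k / 2)

theorem topCoeff_even (g h : ℕ → ℂ) (m : ℕ) :
    topCoeff g h (2 * m) = (-1) ^ m * (transferRow h g (2 * m)).1.coeff m := by
  rw [topCoeff, if_pos (by simp), show 2 * m / 2 = m by omega]

theorem topCoeff_odd (g h : ℕ → ℂ) (m : ℕ) :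
    topCoeff g h (2 * m + 1) = (-1) ^ m * (transferRow g h (2 * m + 1)).2.coeff m := by
  rw [topCoeff, if_neg (by simp), show (2 * m + 1) / 2 = m by omega]

/-- In passing from `k` to `k + 1` the new top coefficient comes entirely from the last matrix; the
remaining product of the two rows' top coefficients telescopes by `coeff_fst_transferRow_mul`. The
signs in `topCoeff` cancel the `-X` of the recursion. -/
theorem topCoeff_succ_mul (g h : ℕ → ℂ) (k : ℕ) :
    topCoeff g h (k + 1) * topCoeff g h k = h k * ∏ i ∈ Finset.range k, g i * h i := by
  have hs (m : ℕ) : ((-1 : ℂ) ^ m) ^ 2 = 1 := by rw [← pow_mul, mul_comm, pow_mul]; simp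
  obtain ⟨m, rfl | rfl⟩ := Nat.even_or_odd' k
  · rw [topCoeff_odd, topCoeff_even, coeff_snd_transferRow_succ, ← coeff_fst_transferRow_mul]
    linear_combination (h (2 * m) * (transferRow g h (2 * m)).1.coeff m *
      (transferRow h g (2 * m)).1.coeff m) * hs m
  · rw [topCoeff_odd, show 2 * m + 1 + 1 = 2 * (m + 1) by ring, topCoeff_even,
      show 2 * (m + 1) = 2 * m + 2 by ring, coeff_fst_transferRow_succ,
      coeff_snd_transferRow_succ, coeff_snd_transferRow_succ, Finset.prod_range_succ,
      ← coeff_fst_transferRow_mul, pow_succ]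
    linear_combination (h (2 * m + 1) * g (2 * m) * h (2 * m) *
      (transferRow g h (2 * m)).1.coeff m * (transferRow h g (2 * m)).1.coeff m) * hs m

/-- The interpolation data `W = q / p` at the nodes determine the Hankel determinants up to the
top coefficient. -/
theorem det_hankel_transferRow {g h : ℕ → ℂ} {s : Finset ℕ} {x W : ℕ → ℂ}
    (hx : Set.InjOn x s)
    (hW : ∀ i ∈ s, W i * (transferRow h g s.card).1.eval (x i) =
      (transferRow g h s.card).2.eval (x i))
    (hW' : ∀ i ∈ s, (transferRow g h s.card).1.eval (x i) =
      -(x i * (transferRow h g s.card).2.eval (x i) * W i)) :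
    (hankel (fun n => dividedDiff s x W (X ^ n)) (s.card / 2) 1).det ≠ 0 ∧
      (hankel (fun n => dividedDiff s x W (X ^ n)) ((s.card + 1) / 2) 0).det =
        topCoeff g h s.card *
          (hankel (fun n => dividedDiff s x W (X ^ n)) (s.card / 2) 1).det := by
  constructor
  · refine det_hankel_ne_zero hx rfl (degree_transferRow h g _).1 (degree_transferRow g h _).2
      (degree_transferRow g h _).1 (degree_transferRow h g _).2 hW hW' ?_
    rw [transferRow_det]
    refine Finset.prod_ne_zero_iff.2 fun i _ h0 => ?_
    -- Each factor has constant term 1.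
    simpa using congrArg (coeff · 0) h0
  · have d1 := (degree_transferRow h g s.card).1
    have d2 := (degree_transferRow g h s.card).2
    obtain ⟨m, hm | hm⟩ := Nat.even_or_odd' s.card
    · rw [hm] at hW d1 d2 ⊢
      rw [show 2 * m / 2 = m by omega] at d1 ⊢
      rw [show (2 * m + 1) / 2 = m by omega] at d2 ⊢
      rw [topCoeff_even]
      exact det_hankel_eq_coeff_denominator hx hm d1 d2 (coeff_zero_transferRow _ _ _) hW
    · rw [hm] at hW d1 d2 ⊢
      rw [show (2 * m + 1) / 2 = m by omega] at d1 ⊢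
      rw [show (2 * m + 1 + 1) / 2 = m + 1 by omega] at d2 ⊢
      rw [topCoeff_odd]
      exact det_hankel_eq_coeff_numerator hx hm d1 d2 (coeff_zero_transferRow _ _ _) hW

/-! ### Transfer matrices and nodes of a peakon configuration. -/

namespace PeakonConfig

variable {N : ℕ} (P : PeakonConfig N)

/-- The weights `g_j`, numbered from the right end. -/
def revG (i : ℕ) : ℂ := P.g (N - i)

/-- The weights `h_j`, numbered from the right end. -/
def revH (i : ℕ) : ℂ := P.h (N - i)

theorem q_p_eq_transferRow {k : ℕ} (hk : k ≤ N) :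
    P.q N = (transferRow P.revG P.revH k).1 * P.q (N - k) +
        (transferRow P.revG P.revH k).2 * P.p (N - k) ∧
      P.p N = -(X * (transferRow P.revH P.revG k).2) * P.q (N - k) +
        (transferRow P.revH P.revG k).1 * P.p (N - k) := by
  induction k with
  | zero => simp [transferRow]
  | succ k ih =>
    obtain ⟨h1, h2⟩ := ih (by omega)
    have e : N - k = N - (k + 1) + 1 := by omega
    have hq : P.q (N - k) = P.q (N - (k + 1)) + C (P.revH k) * P.p (N - (k + 1)) := by
      rw [revH, e]; rfl
    have hp : P.p (N - k) = P.p (N - (k + 1)) - X * C (P.revG k) * P.q (N - (k + 1)) := by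
      rw [revG, e]; rfl
    rw [hq, hp] at h1 h2
    constructor
    · rw [h1]
      simp only [transferRow]
      ring
    · rw [h2]
      simp only [transferRow]
      ring

theorem g_mul_h (j : ℕ) : P.g j * P.h j = (P.absm j : ℂ) ^ 2 := by
  have h1 : Complex.exp (-(P.x j : ℂ)) * Complex.exp (P.x j : ℂ) = 1 := by
    rw [← Complex.exp_add]; simp
  have h2 : (starRingEnd ℂ) (Complex.exp (Complex.I * (P.ω j : ℂ))) *
      Complex.exp (Complex.I * (P.ω j : ℂ)) = 1 := by
    rw [← Complex.exp_conj, ← Complex.exp_add]; simp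
  rw [g, h, m, map_mul, Complex.conj_ofReal]
  linear_combination (P.absm j : ℂ) ^ 2 * (starRingEnd ℂ) (Complex.exp (Complex.I * (P.ω j : ℂ))) *
      Complex.exp (Complex.I * (P.ω j : ℂ)) * h1 + (P.absm j : ℂ) ^ 2 * h2

theorem e_pos {j : ℕ} (h1 : 1 ≤ j) (hN : j ≤ N) : 0 < P.e j :=
  div_pos one_pos (pow_pos (P.absm_pos _ ⟨by omega, by omega⟩) 2)

theorem e_injOn (hdist : Set.InjOn P.absm (Set.Icc 1 N)) : Set.InjOn P.e (Set.Icc 1 N) := by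
  rintro i ⟨hi1, hi2⟩ j ⟨hj1, hj2⟩ hij
  have mi : N - i + 1 ∈ Set.Icc 1 N := ⟨by omega, by omega⟩
  have mj : N - j + 1 ∈ Set.Icc 1 N := ⟨by omega, by omega⟩
  rw [e, e, one_div, one_div, inv_inj,
    sq_eq_sq₀ (P.absm_pos _ mi).le (P.absm_pos _ mj).le] at hij
  have := hdist mi mj hij
  omega

theorem prod_revG_mul_revH (k : ℕ) (hk : k ≤ N) :
    ((P.eProd k : ℝ) : ℂ) * ∏ i ∈ Finset.range k, P.revG i * P.revH i = 1 := by
  have h1 : P.eProd k = ∏ i ∈ Finset.range k, P.e (i + 1) := by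
    rw [eProd, Finset.range_eq_Ico, Finset.prod_Ico_add' P.e 0 k 1]
    rfl
  rw [h1, Complex.ofReal_prod, ← Finset.prod_mul_distrib]
  refine Finset.prod_eq_one fun i hi => ?_
  rw [Finset.mem_range] at hi
  have hpos := P.absm_pos (N - i) ⟨by omega, by omega⟩
  have h0 : (P.absm (N - i) : ℂ) ≠ 0 := by exact_mod_cast hpos.ne'
  rw [revG, revH, g_mul_h, e, show N - (i + 1) + 1 = N - i by omega]
  push_cast
  field_simp

end PeakonConfig

/-! ### Identification of `detD` and the determinant quotients. -/

/-- With nodes `-e i` the nodal polynomial at `ζ t` is $\prod_i(\zeta_t+e_i)$, whose product over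
`J` is `gammaOn`. The largest moment used has order `2 * l + p - 2`, so the case split of `detD`
records whether the moment of order `k - 1`, which carries `c`, occurs. -/
theorem detD_eq_det_hankel {K k l p : ℕ} {e ζ b W : ℕ → ℂ} {c : ℂ}
    (he : Set.InjOn e (Set.Icc 1 k)) (hl : 2 * l + p ≤ k + 1) (hp : p ≤ 1) (hk : k = 0 → l = 0)
    (hζ : ∀ t ∈ Finset.Icc 1 K, ∀ i ∈ Finset.Icc 1 k, ζ t ≠ -e i)
    (hW : ∀ i ∈ Finset.Icc 1 k, W i = c + ∑ t ∈ Finset.Icc 1 K, b t / (ζ t - -e i)) :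
    detD K e ζ b c k l p = vandermondeOn (Finset.Icc 1 k) e *
      (hankel (fun n => dividedDiff (Finset.Icc 1 k) (fun i => -e i) W (X ^ n)) l p).det := by
  rcases Nat.eq_zero_or_pos k with rfl | hk0
  · obtain rfl := hk rfl
    simp [detD, vandermondeOn]
  have hx : Set.InjOn (fun i => -e i) (Finset.Icc 1 k : Finset ℕ) := by
    intro i hi j hj h
    exact he (by simpa using hi) (by simpa using hj) (neg_injective h)
  have hcard : (Finset.Icc 1 k).card = k := by simp
  set w : ℕ → ℂ := fun t => b t / (Lagrange.nodal (Finset.Icc 1 k) fun i => -e i).eval (ζ t)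
  have hmom (n : ℕ) (hn : n < k) :
      dividedDiff (Finset.Icc 1 k) (fun i => -e i) W (X ^ n) =
        ∑ t ∈ Finset.Icc 1 K, w t * ζ t ^ n + if n = k - 1 then c else 0 := by
    have := dividedDiff_X_pow_of_partialFraction hx hζ hW (n := n) (by rwa [hcard])
    rwa [hcard] at this
  have hterm (l : ℕ) : (hankel (fun n => ∑ t ∈ Finset.Icc 1 K, w t * ζ t ^ n) l p).det =
      ∑ J ∈ (Finset.Icc 1 K).powerset with J.card = l, cauchyTerm e ζ b k p J := by
    rw [det_hankel_discrete, Finset.powersetCard_eq_filter]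
    refine Finset.sum_congr rfl fun J _ => ?_
    have hG : gammaOn (Finset.Icc 1 k) J e ζ =
        ∏ t ∈ J, (Lagrange.nodal (Finset.Icc 1 k) fun i => -e i).eval (ζ t) := by
      rw [gammaOn, Finset.prod_comm]
      refine Finset.prod_congr rfl fun t _ => ?_
      rw [Lagrange.eval_nodal]
      exact Finset.prod_congr rfl fun i _ => by ring
    rw [cauchyTerm, hG, Finset.prod_mul_distrib, Finset.prod_div_distrib, Finset.prod_pow]
    ring
  rw [detD, if_neg hk0.ne']
  by_cases h : c = 0 ∨ (p : ℤ) + l - 1 < (k : ℤ) - l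
  · rw [if_pos h, ← hterm]
    congr 2
    refine (hankel_congr fun n hn => ?_).symm
    rw [hmom n (by omega)]
    rcases h with rfl | h
    · simp
    · rw [if_neg (by omega), add_zero]
  · rw [if_neg h, if_pos (by omega)]
    push Not at h
    -- Here `2 * l + p = k + 1 ≥ 2`, and `p ≤ 1` forces `l ≥ 1`.
    obtain ⟨l, rfl⟩ : ∃ l', l = l' + 1 := ⟨l - 1, by omega⟩
    congr 1
    rw [← hterm, hankel_congr fun n hn => hmom n (by omega),
      det_hankel_add_single _ l p (k - 1) (by omega), hterm l]
    simp only [Nat.add_right_cancel_iff]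

theorem PeakonConfig.h_ne_zero {N : ℕ} (P : PeakonConfig N) {j : ℕ} (hj : j ∈ Set.Icc 1 N) :
    P.h j ≠ 0 :=
  mul_ne_zero (mul_ne_zero (by exact_mod_cast (P.absm_pos j hj).ne') (Complex.exp_ne_zero _))
    (Complex.exp_ne_zero _)

/-- The determinants entering the reconstruction formulae are non-zero, and their quotients are
the top coefficients of the interpolating fractions. -/
theorem PeakonConfig.D_ne_zero_and_eq {N : ℕ} (P : PeakonConfig N)
    (hdist : Set.InjOn P.absm (Set.Icc 1 N))
    {ζ b : ℕ → ℂ} {c : ℂ} (hdata : P.IsSpectralData ζ b c)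
    (hneg : ∀ z ∈ P.spectrum, ¬ (z.im = 0 ∧ z.re < 0)) {k : ℕ} (hkN : k ≤ N) :
    P.D ζ b c k (k / 2) 1 ≠ 0 ∧
      P.D ζ b c k ((k + 1) / 2) 0 = topCoeff P.revG P.revH k * P.D ζ b c k (k / 2) 1 := by
  set e : ℕ → ℂ := fun j => (P.e j : ℂ) with he_def
  have hsub : Set.Icc 1 k ⊆ Set.Icc 1 N := Set.Icc_subset_Icc le_rfl hkN
  have he : Set.InjOn e (Set.Icc 1 k) := fun i hi j hj h =>
    P.e_injOn hdist (hsub hi) (hsub hj) (Complex.ofReal_injective h)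
  have hnot (i : ℕ) (hi : i ∈ Finset.Icc 1 k) : -e i ∉ P.spectrum := by
    rw [Finset.mem_Icc] at hi
    intro h
    have := P.e_pos hi.1 (hi.2.trans hkN)
    exact hneg _ h ⟨by simp [e], by simpa [e] using this⟩
  have hζ (t) (ht : t ∈ Finset.Icc 1 (N / 2)) (i) (hi : i ∈ Finset.Icc 1 k) : ζ t ≠ -e i := by
    intro h
    refine hnot i hi ?_
    rw [hdata.spectrum_eq, ← h]
    exact ⟨t, by simpa using ht, rfl⟩
  set W : ℕ → ℂ := fun i => P.weyl (-e i) with hW_def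
  have hW (i) (hi : i ∈ Finset.Icc 1 k) := hdata.weyl_eq _ (hnot i hi)
  have hcard : (Finset.Icc 1 k).card = k := by simp
  have hx : Set.InjOn (fun i => -e i) (Finset.Icc 1 k : Finset ℕ) := by
    intro i hi j hj h
    exact he (by simpa using hi) (by simpa using hj) (neg_injective h)
  have hdet (i) (hi : i ∈ Finset.Icc 1 k) :
      (∏ j ∈ Finset.range k, (1 + X * C (P.revG j * P.revH j))).eval (-e i) = 0 := by
    rw [Finset.mem_Icc] at hi
    rw [eval_prod]
    -- `revG` and `revH` count from 0, so the factor for `e i` has index `i - 1`; it is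
    -- $1-e_i|m_{i'}|^2$.
    refine Finset.prod_eq_zero (i := i - 1) (by simp; omega) ?_
    have h0 : (P.absm (N - i + 1) : ℂ) ≠ 0 := by
      exact_mod_cast (P.absm_pos (N - i + 1) ⟨by omega, by omega⟩).ne'
    rw [PeakonConfig.revG, PeakonConfig.revH, P.g_mul_h, show N - (i - 1) = N - i + 1 by omega]
    simp only [e, PeakonConfig.e, eval_add, eval_one, eval_mul, eval_X, eval_C]
    push_cast
    field_simp
    ring
  obtain ⟨hq, hp⟩ := P.q_p_eq_transferRow hkN
  have hTdet := transferRow_det P.revG P.revH k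
  have hpN (i) (hi : i ∈ Finset.Icc 1 k) : (P.p N).eval (-e i) ≠ 0 := hnot i hi
  have key := det_hankel_transferRow (g := P.revG) (h := P.revH) (W := W) hx ?_ ?_
  · rw [hcard] at key
    have hV : vandermondeOn (Finset.Icc 1 k) e ≠ 0 := vandermondeOn_ne_zero (by simpa using he)
    rw [PeakonConfig.D, PeakonConfig.D, detD_eq_det_hankel he (by omega) le_rfl (by omega) hζ hW,
      detD_eq_det_hankel he (by omega) zero_le_one (by omega) hζ hW]
    exact ⟨mul_ne_zero hV key.1, by rw [key.2]; ring⟩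
  · intro i hi
    rw [hcard]
    -- Elimination of `p (N - k)` leaves the determinant times `q (N - k)`, which vanishes at the
    -- nodes.
    have e1 : (transferRow P.revH P.revG k).1 * P.q N - (transferRow P.revG P.revH k).2 * P.p N =
        (∏ j ∈ Finset.range k, (1 + X * C (P.revG j * P.revH j))) * P.q (N - k) := by
      rw [hq, hp, ← hTdet]; ring
    have e2 := congrArg (eval (-e i)) e1
    rw [eval_mul, hdet i hi, zero_mul, eval_sub, eval_mul, eval_mul] at e2
    simp only [hW_def, PeakonConfig.weyl]
    rw [div_mul_eq_mul_div, div_eq_iff (hpN i hi)]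
    linear_combination e2
  · intro i hi
    rw [hcard]
    -- Likewise, with `q (N - k)` eliminated.
    have e1 : X * (transferRow P.revH P.revG k).2 * P.q N + (transferRow P.revG P.revH k).1 * P.p N =
        (∏ j ∈ Finset.range k, (1 + X * C (P.revG j * P.revH j))) * P.p (N - k) := by
      rw [hq, hp, ← hTdet]; ring
    have e2 := congrArg (eval (-e i)) e1
    rw [eval_mul, hdet i hi, zero_mul, eval_add, eval_mul, eval_mul, eval_mul, eval_X] at e2
    simp only [hW_def, PeakonConfig.weyl]
    rw [← mul_div_assoc, eq_neg_iff_add_eq_zero, add_div' _ _ _ (hpN i hi),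
      div_eq_zero_iff]
    left
    linear_combination e2

/-! ### Modulus and argument; the reconstruction formulae. -/

theorem log_and_phase_of_mul_eq {M E x ω : ℝ} {a b a' b' : ℂ} (hM : 0 < M) (hE : 0 < E)
    (ha' : a' ≠ 0) (hb' : b' ≠ 0)
    (h : (M : ℂ) * Complex.exp (Complex.I * ω) * Complex.exp x * (a' * b') = E * (a * b)) :
    x = Real.log (E * ‖a‖ * ‖b‖ / (M * ‖a'‖ * ‖b'‖)) ∧
      Complex.exp (Complex.I * ω) =
        (a * b) / (a' * b') * (((‖a'‖ * ‖b'‖) / (‖a‖ * ‖b‖) : ℝ) : ℂ) := by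
  have hna' := norm_pos_iff.2 ha'
  have hnb' := norm_pos_iff.2 hb'
  have hnorm : M * Real.exp x * (‖a'‖ * ‖b'‖) = E * (‖a‖ * ‖b‖) := by
    have := congrArg norm h
    rwa [norm_mul, norm_mul, norm_mul, norm_mul, norm_mul, norm_mul, mul_comm Complex.I,
      Complex.norm_exp_ofReal_mul_I, ← Complex.ofReal_exp, Complex.norm_real, Complex.norm_real,
      Complex.norm_real, Real.norm_of_nonneg hM.le, Real.norm_of_nonneg hE.le,
      Real.norm_of_nonneg (Real.exp_pos x).le, mul_one] at this
  have hab : 0 < ‖a‖ * ‖b‖ := by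
    have : 0 < E * (‖a‖ * ‖b‖) := hnorm ▸ by positivity
    exact (pos_iff_pos_of_mul_pos this).1 hE
  constructor
  · rw [← Real.log_exp x]
    congr 1
    rw [eq_div_iff (by positivity)]
    linear_combination hnorm
  · have hxc : (Real.exp x : ℂ) = E * (‖a‖ * ‖b‖) / (M * (‖a'‖ * ‖b'‖)) := by
      have : Real.exp x = E * (‖a‖ * ‖b‖) / (M * (‖a'‖ * ‖b'‖)) := by
        rw [eq_div_iff (by positivity)]
        linear_combination hnorm
      exact_mod_cast congrArg (Complex.ofReal) this
    rw [← Complex.ofReal_exp, hxc] at h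
    have hM' : (M : ℂ) ≠ 0 := by exact_mod_cast hM.ne'
    have hE' : (E : ℂ) ≠ 0 := by exact_mod_cast hE.ne'
    have h1 : (‖a'‖ : ℂ) ≠ 0 := by exact_mod_cast hna'.ne'
    have h2 : (‖b'‖ : ℂ) ≠ 0 := by exact_mod_cast hnb'.ne'
    have h3 : (‖a‖ : ℂ) ≠ 0 := by exact_mod_cast left_ne_zero_of_mul hab.ne'
    have h4 : (‖b‖ : ℂ) ≠ 0 := by exact_mod_cast right_ne_zero_of_mul hab.ne'
    push_cast
    field_simp at h ⊢
    linear_combination h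

/-- Floor halves treat both parities at once: $\mathcal D_k$ and $\mathcal D_{k-1}$ enter through
one quotient each, the top coefficients at `k` and `k - 1`. -/
theorem PeakonConfig.reconstruction {N : ℕ} (P : PeakonConfig N)
    (hdist : Set.InjOn P.absm (Set.Icc 1 N))
    {ζ b : ℕ → ℂ} {c : ℂ} (hdata : P.IsSpectralData ζ b c)
    (hneg : ∀ z ∈ P.spectrum, ¬ (z.im = 0 ∧ z.re < 0)) {k : ℕ} (hk1 : 1 ≤ k) (hkN : k ≤ N) :
    (P.D ζ b c k ((k + 1) / 2) 0 ≠ 0 ∧ P.D ζ b c (k - 1) (k / 2) 0 ≠ 0 ∧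
        P.D ζ b c k (k / 2) 1 ≠ 0 ∧ P.D ζ b c (k - 1) ((k - 1) / 2) 1 ≠ 0) ∧
      P.x (N - k + 1) =
        Real.log (P.eProd (k - 1) *
            ‖P.D ζ b c k ((k + 1) / 2) 0‖ * ‖P.D ζ b c (k - 1) (k / 2) 0‖ /
          (P.absm (N - k + 1) *
            ‖P.D ζ b c k (k / 2) 1‖ * ‖P.D ζ b c (k - 1) ((k - 1) / 2) 1‖)) ∧
      Complex.exp (Complex.I * (P.ω (N - k + 1) : ℂ)) =
        (P.D ζ b c k ((k + 1) / 2) 0 * P.D ζ b c (k - 1) (k / 2) 0) /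
          (P.D ζ b c k (k / 2) 1 * P.D ζ b c (k - 1) ((k - 1) / 2) 1) *
        (((‖P.D ζ b c k (k / 2) 1‖ * ‖P.D ζ b c (k - 1) ((k - 1) / 2) 1‖) /
          (‖P.D ζ b c k ((k + 1) / 2) 0‖ * ‖P.D ζ b c (k - 1) (k / 2) 0‖) : ℝ) : ℂ) := by
  obtain ⟨k, rfl⟩ : ∃ n, k = n + 1 := ⟨k - 1, by omega⟩
  rw [Nat.add_sub_cancel]
  have hj : N - (k + 1) + 1 ∈ Set.Icc 1 N := ⟨by omega, by omega⟩
  have hE : 0 < P.eProd k := Finset.prod_pos fun i hi => by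
    rw [Finset.mem_Icc] at hi
    exact P.e_pos hi.1 (by omega)
  have hE' : (P.eProd k : ℂ) ≠ 0 := by exact_mod_cast hE.ne'
  obtain ⟨n1, e1⟩ := P.D_ne_zero_and_eq hdist hdata hneg hkN
  obtain ⟨n2, e2⟩ := P.D_ne_zero_and_eq hdist hdata hneg (show k ≤ N by omega)
  have htop := topCoeff_succ_mul P.revG P.revH k
  have hprod := P.prod_revG_mul_revH k (by omega)
  have hrev : P.revH k = P.h (N - (k + 1) + 1) := by
    rw [PeakonConfig.revH, show N - (k + 1) + 1 = N - k by omega]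
  have hmain : P.h (N - (k + 1) + 1) =
      P.eProd k * (topCoeff P.revG P.revH (k + 1) * topCoeff P.revG P.revH k) := by
    rw [htop, ← hrev]
    linear_combination (-P.revH k) * hprod
  -- Both top coefficients are non-zero because `h` is, hence so are the determinants with `p = 0`.
  have hne := right_ne_zero_of_mul (hmain ▸ P.h_ne_zero hj)
  refine ⟨⟨?_, ?_, n1, n2⟩, log_and_phase_of_mul_eq (P.absm_pos _ hj) hE n1 n2 ?_⟩
  · rw [e1]
    exact mul_ne_zero (left_ne_zero_of_mul hne) n1
  · rw [e2]
    exact mul_ne_zero (right_ne_zero_of_mul hne) n2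
  · rw [e1, e2]
    change P.h (N - (k + 1) + 1) * _ = _
    rw [hmain]
    ring

end

theorem mainTheorem5 (N : ℕ) (P : PeakonConfig N)
    (hdist : Set.InjOn P.absm (Set.Icc 1 N))
    (ζ b : ℕ → ℂ) (c : ℂ) (hdata : P.IsSpectralData ζ b c)
    (hneg : ∀ z ∈ P.spectrum, ¬ (z.im = 0 ∧ z.re < 0))
    (k : ℕ) (hk1 : 1 ≤ k) (hkN : k ≤ N) :
    (Odd k →
      (P.D ζ b c k ((k + 1) / 2) 0 ≠ 0 ∧ P.D ζ b c (k - 1) ((k - 1) / 2) 0 ≠ 0 ∧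
        P.D ζ b c k ((k - 1) / 2) 1 ≠ 0 ∧ P.D ζ b c (k - 1) ((k - 1) / 2) 1 ≠ 0) ∧
      P.x (N - k + 1) =
        Real.log (P.eProd (k - 1) *
            ‖P.D ζ b c k ((k + 1) / 2) 0‖ * ‖P.D ζ b c (k - 1) ((k - 1) / 2) 0‖ /
          (P.absm (N - k + 1) *
            ‖P.D ζ b c k ((k - 1) / 2) 1‖ * ‖P.D ζ b c (k - 1) ((k - 1) / 2) 1‖)) ∧
      Complex.exp (Complex.I * (P.ω (N - k + 1) : ℂ)) =
        (P.D ζ b c k ((k + 1) / 2) 0 * P.D ζ b c (k - 1) ((k - 1) / 2) 0) /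
          (P.D ζ b c k ((k - 1) / 2) 1 * P.D ζ b c (k - 1) ((k - 1) / 2) 1) *
        (((‖P.D ζ b c k ((k - 1) / 2) 1‖ * ‖P.D ζ b c (k - 1) ((k - 1) / 2) 1‖) /
          (‖P.D ζ b c k ((k + 1) / 2) 0‖ * ‖P.D ζ b c (k - 1) ((k - 1) / 2) 0‖) : ℝ) : ℂ)) ∧
    (Even k →
      (P.D ζ b c k (k / 2) 0 ≠ 0 ∧ P.D ζ b c (k - 1) (k / 2) 0 ≠ 0 ∧
        P.D ζ b c k (k / 2) 1 ≠ 0 ∧ P.D ζ b c (k - 1) (k / 2 - 1) 1 ≠ 0) ∧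
      P.x (N - k + 1) =
        Real.log (P.eProd (k - 1) *
            ‖P.D ζ b c k (k / 2) 0‖ * ‖P.D ζ b c (k - 1) (k / 2) 0‖ /
          (P.absm (N - k + 1) *
            ‖P.D ζ b c k (k / 2) 1‖ * ‖P.D ζ b c (k - 1) (k / 2 - 1) 1‖)) ∧
      Complex.exp (Complex.I * (P.ω (N - k + 1) : ℂ)) =
        (P.D ζ b c k (k / 2) 0 * P.D ζ b c (k - 1) (k / 2) 0) /
          (P.D ζ b c k (k / 2) 1 * P.D ζ b c (k - 1) (k / 2 - 1) 1) *
        (((‖P.D ζ b c k (k / 2) 1‖ * ‖P.D ζ b c (k - 1) (k / 2 - 1) 1‖) /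
          (‖P.D ζ b c k (k / 2) 0‖ * ‖P.D ζ b c (k - 1) (k / 2) 0‖) : ℝ) : ℂ)) := by
  have h := P.reconstruction hdist hdata hneg hk1 hkN
  constructor
  · rintro ⟨m, rfl⟩
    rwa [show (2 * m + 1) / 2 = (2 * m + 1 - 1) / 2 by omega] at h
  · rintro ⟨m, rfl⟩
    rwa [show (m + m + 1) / 2 = (m + m) / 2 by omega,
      show (m + m - 1) / 2 = (m + m) / 2 - 1 by omega] at h
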